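/- Let $A\in\{0,1\}^{m\times n}$, $b\in\mathbb Z^m$, $w\in\mathbb R^n$ and $X\in\mathbb N^n$, and assume that the covering LP $$\min\{w^Tx \mid Ax\ge b,\ 0\le x_i\le X_i \text{ for all } i\}$$ is feasible. Let $\mathrm{OPT}_{LP}$ denote its set of optimal solutions, and for $r\in\{1,\dots,n\}$ put $x_r^{\min}=\min\{x_r\mid x\in \mathrm{OPT}_{LP}\}$ and $x_r^{\max}=\max\{x_r\mid x\in \mathrm{OPT}_{LP}\}$. The min-sum-covering algorithm with $t\in\mathbb N$ iterations runs the following min-sum-packing algorithm for the complementary packing problem $\max\{w^Tx\mid Ax\le d,\ x_i\in\{0,\dots,X_i\} \text{ for all } i\}$ with $d=AX-b$. Let $\mathcal N$ denote neighbourhoods in the bipartite graph with variable vertices $v\in\{1,\dots,n\}$, constraint vertices $C\in\{1,\dots,m\}$, and an edge $(v,C)$ whenever $A_{Cv}=1$. For every edge $(v,C)$ and every $\beta\in\{0,\dots,X_v\}$ set $\mu^{(0)}_{C\to v}(\beta)=0$, and for $t'=1,\dots,t$ $$\mu^{(t')}_{v\to C}(\beta)=w_v\beta+\sum_{C'\in\mathcal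 N(v)\setminus\{C\}}\mu^{(t'-1)}_{C'\to v}(\beta),$$ $$\mu^{(t')}_{C\to v}(\beta)=\max\Big\{\sum_{u\in\mathcal N(C)\setminus\{v\}}\mu^{(t')}_{u\to C}(z_u)\ \Big|\ z\in\prod_{i}\{0,\dots,X_i\},\ z_v=\beta,\ \sum_{u\in\mathcal N(C)}z_u\le d_C\Big\},$$ where $\max\emptyset=-\infty$. Finally let $\mu_v(\beta)=w_v\beta+\sum_{C\in\mathcal N(v)}\mu^{(t)}_{C\to v}(\beta)$. The set of optimal values of min-sum-covering at the variable vertex $r$ after $t$ iterations is $$\delta_{r,t}=\{X_r-\beta\mid \beta\in\{0,\dots,X_r\},\ \mu_r(\beta)=\max_{0\le\beta'\le X_r}\mu_r(\beta')\}.$$ Then for every $r$ the following hold. 1. If $t$ is even, then $\min\delta_{r,t}\le x_r^{\min}$. 2. If $t$ is odd, then $\max\delta_{r,t}\ge x_r^{\max}$. -/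

import Mathlib

namespace MinSum

/-- The factor graph model of an integer program with variable vertices `V` and constraint
vertices `C`. The bipartite graph on `V ∪ C` is given by its incidence relation `Adj`; the alphabet
of a variable vertex `v` is `{0, …, X v}`; the factor function `ψ c` takes the value `⊥` (that is,
`-∞`) on the assignments which violate the constraint `c`. -/
structure FactorGraphModel (V C : Type*) where
  Adj : V → C → Prop
  ψ : C → (V → ℕ) → WithBot ℝ
  φ : V → ℕ → ℝ
  X : V → ℕ

namespace FactorGraphModel

variable {V C : Type*} [Fintype V] [Fintype C] [DecidableEq V] [DecidableEq C]

open Classical in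
/-- The neighbours of a variable vertex. -/
noncomputable def varNbrs (F : FactorGraphModel V C) (v : V) : Finset C :=
  Finset.univ.filter fun c => F.Adj v c

open Classical in
/-- The neighbours of a constraint vertex. -/
noncomputable def conNbrs (F : FactorGraphModel V C) (c : C) : Finset V :=
  Finset.univ.filter fun v => F.Adj v c

/-- The integral box `{0, …, X v₁} × ⋯ × {0, …, X vₙ}`. -/
def zbox (F : FactorGraphModel V C) : Finset (V → ℕ) :=
  Fintype.piFinset fun v => Finset.range (F.X v + 1)

/-- The variable-to-constraint message, computed from the previous constraint-to-variable
messages `μ`. -/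
noncomputable def varMessage (F : FactorGraphModel V C) (μ : C → V → ℕ → WithBot ℝ)
    (v : V) (c : C) (β : ℕ) : WithBot ℝ :=
  (F.φ v β : WithBot ℝ) + ∑ c' ∈ (F.varNbrs v).erase c, μ c' v β

open Classical in
/-- The constraint-to-variable message, computed from the variable-to-constraint messages `ν` of
the same iteration. The maximum over the empty set is `-∞`. -/
noncomputable def conMessage (F : FactorGraphModel V C) (ν : V → C → ℕ → WithBot ℝ)
    (c : C) (v : V) (β : ℕ) : WithBot ℝ :=
  (F.zbox.filter fun z => z v = β ∧ F.ψ c z = 0).sup fun z =>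
    ∑ u ∈ (F.conNbrs c).erase v, ν u c (z u)

/-- The constraint-to-variable messages after `t` iterations, with zero initialization. Only the
values at adjacent pairs and at letters `β ≤ X v` are ever used. -/
noncomputable def message (F : FactorGraphModel V C) : ℕ → C → V → ℕ → WithBot ℝ
  | 0 => fun _ _ _ => 0
  | t + 1 => F.conMessage (F.varMessage (F.message t))

/-- The final value computed by the variable vertex `v` for the letter `β`. -/
noncomputable def finalValue (F : FactorGraphModel V C) (t : ℕ) (v : V) (β : ℕ) : WithBot ℝ :=
  (F.φ v β : WithBot ℝ) + ∑ c ∈ F.varNbrs v, F.message t c v β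

open Classical in
/-- The set `δ_{v,t}` of the letters that maximize the final value at `v` in the execution of
min-sum-packing with `t` iterations. -/
noncomputable def packingDelta (F : FactorGraphModel V C) (t : ℕ) (v : V) : Finset ℕ :=
  (Finset.range (F.X v + 1)).filter fun β =>
    F.finalValue t v β = (Finset.range (F.X v + 1)).sup (F.finalValue t v)

end FactorGraphModel

open Classical in
/-- The factor graph model of the packing integer program
`argmax {wᵀ x | A x ≤ d, x integral, 0 ≤ x ≤ X}`, for a zero-one matrix `A`. -/
noncomputable def packingModel {m n : ℕ} (A : Matrix (Fin m) (Fin n) ℤ) (d : Fin m → ℤ)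
    (w : Fin n → ℝ) (X : Fin n → ℕ) : FactorGraphModel (Fin n) (Fin m) where
  Adj i j := A j i = 1
  ψ j y := if ∑ i ∈ Finset.univ.filter (fun i => A j i = 1), (y i : ℤ) ≤ d j then 0 else ⊥
  φ i β := w i * (β : ℝ)
  X := X

/-- The set `δ_{r,t}` of the execution of min-sum-covering with `t` iterations on the covering
problem given by `A`, `b`, `w`, `X`: the algorithm runs min-sum-packing on the packing problem with
right-hand side `A X - b`, and complements the values `β` found there to `X r - β`. (These
`β` are at most `X r`, so the subtraction is not truncated.) -/
noncomputable def coveringDelta {m n : ℕ} (A : Matrix (Fin m) (Fin n) ℤ) (b : Fin m → ℤ)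
    (w : Fin n → ℝ) (X : Fin n → ℕ) (t : ℕ) (r : Fin n) : Finset ℕ :=
  ((packingModel A (A.mulVec (fun i => (X i : ℤ)) - b) w X).packingDelta t r).image
    fun β => X r - β

/-- The feasible region of the covering LP: `A x ≥ b` and `0 ≤ x ≤ X`. -/
def coveringFeasible {m n : ℕ} (A : Matrix (Fin m) (Fin n) ℤ) (b : Fin m → ℤ)
    (X : Fin n → ℕ) : Set (Fin n → ℝ) :=
  {x | (∀ j, (b j : ℝ) ≤ ∑ i, (A j i : ℝ) * x i) ∧ ∀ i, 0 ≤ x i ∧ x i ≤ (X i : ℝ)}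

/-- The set of optimal solutions of the covering LP. -/
def coveringOpt {m n : ℕ} (A : Matrix (Fin m) (Fin n) ℤ) (b : Fin m → ℤ)
    (w : Fin n → ℝ) (X : Fin n → ℕ) : Set (Fin n → ℝ) :=
  {x | x ∈ coveringFeasible A b X ∧
    ∀ y ∈ coveringFeasible A b X, ∑ i, w i * x i ≤ ∑ i, w i * y i}

end MinSum

namespace MinSum

open Finset

/-! The proof is an LP exchange argument along the computation tree of the algorithm. Fix an optimum
`x` of the packing LP and move the letter `β` at the root by a unit step `s = ±1` towards `x r`.
Each constraint below either absorbs the step or passes the opposite step `-s`, again towards `x`,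
to one other neighbour (`hasDeviations_conMessage`); each variable passes its step to all its other
constraints (`hasDeviations_varValue`). Added up over the tree, the steps form a vector `D` such
that `x - ε D` is feasible for small `ε > 0`, so optimality of `x` gives `w · D ≥ 0`
(`IsDeviation.weight_nonneg`). As the final value grows by at least `w · D`, the moved letter is
still a maximizer.

Signs alternate along the tree, and the initial zero messages allow the recursion to stop only at a
positive step. This forces `s = (-1) ^ t` at the root, whence the dependence on parity. Thus
maximizers can be pushed past every LP optimum, upwards for even `t` and downwards for odd `t`;
complementing by `X` reverses the direction for covering. -/

variable {m n : ℕ} {A : Matrix (Fin m) (Fin n) ℤ} {d : Fin m → ℤ} {w : Fin n → ℝ} {X : Fin n → ℕ}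

/-! ### Deviations from an LP optimum. -/

/-- `D` is a direction in which the point `x` of the packing polytope can be decreased, as far as
the box constraints are concerned, and whose sum over each tight constraint `c` is at least `e c`. -/
structure IsDeviation (A : Matrix (Fin m) (Fin n) ℤ) (d : Fin m → ℤ) (X : Fin n → ℕ)
    (x : Fin n → ℝ) (e : Fin m → ℝ) (D : Fin n → ℝ) : Prop where
  nonpos : ∀ v, x v = 0 → D v ≤ 0
  nonneg : ∀ v, x v = X v → 0 ≤ D v
  tight : ∀ c, ∑ i with A c i = 1, x i = d c → e c ≤ ∑ i with A c i = 1, D i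

namespace IsDeviation

variable {x : Fin n → ℝ} {e e' : Fin m → ℝ} {D D' : Fin n → ℝ}

theorem zero (he : ∀ c, ∑ i with A c i = 1, x i = d c → e c ≤ 0) :
    IsDeviation A d X x e 0 :=
  ⟨fun _ _ => le_rfl, fun _ _ => le_rfl, fun c hc => by simpa using he c hc⟩

theorem mono (h : IsDeviation A d X x e D) (he : ∀ c, e' c ≤ e c) : IsDeviation A d X x e' D :=
  ⟨h.nonpos, h.nonneg, fun c hc => (he c).trans (h.tight c hc)⟩

theorem add (h : IsDeviation A d X x e D) (h' : IsDeviation A d X x e' D') :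
    IsDeviation A d X x (e + e') (D + D') :=
  ⟨fun v hv => add_nonpos (h.nonpos v hv) (h'.nonpos v hv),
    fun v hv => add_nonneg (h.nonneg v hv) (h'.nonneg v hv), fun c hc => by
      simpa [sum_add_distrib] using add_le_add (h.tight c hc) (h'.tight c hc)⟩

theorem sum {ι : Type*} (S : Finset ι) {e : ι → Fin m → ℝ} {D : ι → Fin n → ℝ}
    (h : ∀ i ∈ S, IsDeviation A d X x (e i) (D i)) :
    IsDeviation A d X x (∑ i ∈ S, e i) (∑ i ∈ S, D i) := by
  classical
  induction S using Finset.induction_on with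
  | empty => exact zero fun _ _ => le_rfl
  | insert a S ha ih =>
    rw [sum_insert ha, sum_insert ha]
    exact (h a (by simp)).add (ih fun i hi => h i (by simp [hi]))

/-- The deviation concentrated at a single variable. -/
theorem single {u : Fin n} {a : ℝ} (h₀ : x u = 0 → a ≤ 0) (h₁ : x u = X u → 0 ≤ a) :
    IsDeviation A d X x (fun c => if A c u = 1 then a else 0) (Pi.single u a) := by
  refine ⟨fun v hv => ?_, fun v hv => ?_, fun c _ => ?_⟩
  · rcases eq_or_ne v u with rfl | h
    · simpa using h₀ hv
    · simp [h]
  · rcases eq_or_ne v u with rfl | h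
    · simpa using h₁ hv
    · simp [h]
  · rw [sum_filter]
    refine le_of_eq ?_
    rw [sum_eq_single u]
    · simp
    · intro b _ hb
      simp [hb]
    · simp

end IsDeviation

/-- A linear constraint with slack `a` survives a small step: positive slack does by continuity, and
zero slack because the direction does not worsen it. -/
theorem eventually_nonneg_sub_mul {a b : ℝ} (ha : 0 ≤ a) (hb : a = 0 → b ≤ 0) :
    ∀ᶠ ε in nhdsWithin (0 : ℝ) (Set.Ioi 0), 0 ≤ a - ε * b := by
  rcases ha.eq_or_lt with rfl | ha
  · filter_upwards [self_mem_nhdsWithin] with ε hε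
    have : ε * b ≤ 0 := mul_nonpos_of_nonneg_of_nonpos (le_of_lt hε) (hb rfl)
    linarith
  · have : Filter.Tendsto (fun ε : ℝ => a - ε * b) (nhds 0) (nhds (a - 0 * b)) :=
      Continuous.tendsto (by fun_prop) 0
    have h := this.eventually (lt_mem_nhds (by simpa using ha : (0 : ℝ) < a - 0 * b))
    exact (h.filter_mono nhdsWithin_le_nhds).mono fun _ h => h.le

/-- The feasible region of the packing LP. -/
def packingFeasible (A : Matrix (Fin m) (Fin n) ℤ) (d : Fin m → ℤ) (X : Fin n → ℕ) :
    Set (Fin n → ℝ) :=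
  {x | (∀ c, ∑ i with A c i = 1, x i ≤ d c) ∧ ∀ i, 0 ≤ x i ∧ x i ≤ X i}

/-- Optimal solutions of the packing LP cannot be improved by a deviation. -/
theorem IsDeviation.weight_nonneg {x D : Fin n → ℝ} {e : Fin m → ℝ}
    (hD : IsDeviation A d X x e D) (he : ∀ c, 0 ≤ e c) (hx : x ∈ packingFeasible A d X)
    (hopt : ∀ y ∈ packingFeasible A d X, ∑ i, w i * y i ≤ ∑ i, w i * x i) :
    0 ≤ ∑ i, w i * D i := by
  have h₁ : ∀ᶠ ε in nhdsWithin (0 : ℝ) (Set.Ioi 0), ∀ i, 0 ≤ x i - ε * D i :=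
    Filter.eventually_all.2 fun i => eventually_nonneg_sub_mul (hx.2 i).1 (hD.nonpos i)
  have h₂ : ∀ᶠ ε in nhdsWithin (0 : ℝ) (Set.Ioi 0), ∀ i, 0 ≤ ((X i : ℝ) - x i) - ε * (-D i) :=
    Filter.eventually_all.2 fun i => eventually_nonneg_sub_mul (sub_nonneg.2 (hx.2 i).2)
      fun h => neg_nonpos.2 (hD.nonneg i (sub_eq_zero.1 h).symm)
  have h₃ : ∀ᶠ ε in nhdsWithin (0 : ℝ) (Set.Ioi 0), ∀ c,
      0 ≤ ((d c : ℝ) - ∑ i with A c i = 1, x i) - ε * (-∑ i with A c i = 1, D i) :=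
    Filter.eventually_all.2 fun c => eventually_nonneg_sub_mul (sub_nonneg.2 (hx.1 c))
      fun h => neg_nonpos.2 ((he c).trans (hD.tight c (sub_eq_zero.1 h).symm))
  obtain ⟨ε, hε₁, hε₂, hε₃, hε⟩ := (h₁.and (h₂.and (h₃.and self_mem_nhdsWithin))).exists
  have hε : 0 < ε := hε
  have key := hopt (fun i => x i - ε * D i) ⟨fun c => ?_, fun i => ⟨hε₁ i, ?_⟩⟩
  · have : ∑ i, w i * (x i - ε * D i) = ∑ i, w i * x i - ε * ∑ i, w i * D i := by
      rw [mul_sum, ← sum_sub_distrib]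
      exact sum_congr rfl fun i _ => by ring
    rw [this] at key
    exact nonneg_of_mul_nonneg_right (by linarith) hε
  · rw [sum_sub_distrib, ← mul_sum]
    linarith [hε₃ c]
  · linarith [hε₂ i]

/-! ### Messages of the packing model. -/

theorem FactorGraphModel.mem_varNbrs {V C : Type*} [Fintype C] (F : FactorGraphModel V C) (v : V)
    (c : C) : c ∈ F.varNbrs v ↔ F.Adj v c := by
  simp [varNbrs]

theorem FactorGraphModel.mem_conNbrs {V C : Type*} [Fintype V] (F : FactorGraphModel V C) (v : V)
    (c : C) : v ∈ F.conNbrs c ↔ F.Adj v c := by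
  simp [conNbrs]

theorem mem_varNbrs {u : Fin n} {c : Fin m} :
    c ∈ (packingModel A d w X).varNbrs u ↔ A c u = 1 := by
  exact FactorGraphModel.mem_varNbrs _ _ _

theorem conNbrs_packingModel (c : Fin m) :
    (packingModel A d w X).conNbrs c = univ.filter fun i => A c i = 1 := by
  ext u
  exact (FactorGraphModel.mem_conNbrs _ _ _).trans (by rw [mem_filter_univ]; rfl)

theorem psi_packingModel_eq_zero {c : Fin m} {z : Fin n → ℕ} :
    (packingModel A d w X).ψ c z = 0 ↔ ∑ i with A c i = 1, (z i : ℤ) ≤ d c := by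
  simp only [packingModel]
  split_ifs with h
  · simpa using by convert h
  · simpa using by convert not_le.1 h

theorem mem_zbox {z : Fin n → ℕ} : z ∈ (packingModel A d w X).zbox ↔ ∀ i, z i ≤ X i := by
  simp [FactorGraphModel.zbox, packingModel]

/-- Every feasible integral assignment bounds a constraint-to-variable message from below. -/
theorem sum_le_conMessage {ν : Fin n → Fin m → ℕ → WithBot ℝ} {c : Fin m} {u : Fin n}
    {z : Fin n → ℕ} (hz : ∀ i, z i ≤ X i) (hc : ∑ i with A c i = 1, (z i : ℤ) ≤ d c) :
    ∑ i ∈ (univ.filter fun i => A c i = 1).erase u, ν i c (z i) ≤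
      (packingModel A d w X).conMessage ν c u (z u) := by
  rw [FactorGraphModel.conMessage, conNbrs_packingModel]
  refine Finset.le_sup (f := fun z : Fin n → ℕ =>
    ∑ i ∈ (univ.filter fun i => A c i = 1).erase u, ν i c (z i)) ?_
  simp only [mem_filter]
  exact ⟨mem_zbox.2 hz, trivial, psi_packingModel_eq_zero.2 hc⟩

/-- A finite constraint-to-variable message is attained by a feasible integral assignment. -/
theorem exists_conMessage_eq {ν : Fin n → Fin m → ℕ → WithBot ℝ} {c : Fin m} {u : Fin n} {β : ℕ}
    (h : (packingModel A d w X).conMessage ν c u β ≠ ⊥) :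
    ∃ z : Fin n → ℕ, (∀ i, z i ≤ X i) ∧ z u = β ∧ ∑ i with A c i = 1, (z i : ℤ) ≤ d c ∧
      (packingModel A d w X).conMessage ν c u β =
        ∑ i ∈ (univ.filter fun i => A c i = 1).erase u, ν i c (z i) := by
  rw [FactorGraphModel.conMessage, conNbrs_packingModel] at *
  obtain ⟨z, hz, hz'⟩ := Finset.exists_mem_eq_sup _ (Finset.nonempty_iff_ne_empty.2 fun h' =>
    h ((congrArg (fun S => Finset.sup S _) h').trans Finset.sup_empty)) fun z : Fin n → ℕ =>
    ∑ i ∈ (univ.filter fun i => A c i = 1).erase u, ν i c (z i)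
  simp only [mem_filter] at hz
  exact ⟨z, mem_zbox.1 hz.1, hz.2.1, psi_packingModel_eq_zero.1 hz.2.2, hz'⟩

theorem withBot_term_ne_bot_of_sum {ι : Type*} {S : Finset ι} {f : ι → WithBot ℝ}
    (h : ∑ i ∈ S, f i ≠ ⊥) {i : ι} (hi : i ∈ S) : f i ≠ ⊥ :=
  fun hf => h (WithBot.sum_eq_bot_iff.2 ⟨i, hi, hf⟩)

/-! ### Propagation of unit steps through the computation tree. -/

/-- If `f β` is finite and the step from `β` to `β + s` goes towards `x u`, then taking this step
changes the value of `f` by at least the weight of some deviation from `x`. -/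
def HasDeviations (A : Matrix (Fin m) (Fin n) ℤ) (d : Fin m → ℤ) (w : Fin n → ℝ) (X : Fin n → ℕ)
    (x : Fin n → ℝ) (u : Fin n) (s : ℤ) (e : Fin m → ℝ) (f : ℕ → WithBot ℝ) : Prop :=
  ∀ β β' : ℕ, β ≤ X u → β' ≤ X u → (β' : ℤ) = β + s → 0 < (s : ℝ) * (x u - β) → f β ≠ ⊥ →
    ∃ D, IsDeviation A d X x e D ∧ f β + ((∑ i, w i * D i : ℝ) : WithBot ℝ) ≤ f β'

theorem exists_step_towards {x : ℝ} {N β : ℕ} {s : ℤ} (hs : s = 1 ∨ s = -1) (h₀ : 0 ≤ x)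
    (hN : x ≤ N) (hβ : β ≤ N) (h : 0 < (s : ℝ) * (x - β)) :
    ∃ β' : ℕ, β' ≤ N ∧ (β' : ℤ) = β + s := by
  rcases hs with rfl | rfl
  · have : (β : ℝ) < N := by push_cast at h; linarith
    exact ⟨β + 1, by exact_mod_cast this, by simp⟩
  · have : (0 : ℝ) < β := by push_cast at h; linarith
    have : 0 < β := by exact_mod_cast this
    exact ⟨β - 1, by omega, by omega⟩

/-- The bound `-s` at `c` reserves room for the step `s` at `u` itself, which is not part of `D`:
once it is added, the sum over `c` changes by a nonnegative amount. If `c` cannot absorb the step,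
comparing the sums of `x` and of the maximizing `z` over `c` yields a neighbour `v ≠ u` at which the
step `-s` goes towards `x`. -/
theorem hasDeviations_conMessage {x : Fin n → ℝ} {ν : Fin n → Fin m → ℕ → WithBot ℝ} {c : Fin m}
    {u : Fin n} {s : ℤ} (hs : s = 1 ∨ s = -1) (hx : x ∈ packingFeasible A d X) (hu : A c u = 1)
    (hν : ∀ v, A c v = 1 → HasDeviations A d w X x v (-s) (Pi.single c (-s : ℝ)) (ν v c)) :
    HasDeviations A d w X x u s (Pi.single c (-s : ℝ))
      ((packingModel A d w X).conMessage ν c u) := by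
  intro β β' hβ hβ' hββ' hsx hbot
  obtain ⟨z, hzX, rfl, hzc, hmax⟩ := exists_conMessage_eq hbot
  have huN : u ∈ univ.filter fun i => A c i = 1 := by simpa using hu
  have hsum_update : ∀ i, (Function.update z u β' i : ℤ) = z i + if i = u then s else 0 := by
    intro i
    rcases eq_or_ne i u with rfl | h
    · simp [hββ']
    · simp [h]
  have hle_update : ∀ i, Function.update z u β' i ≤ X i := by
    intro i
    rcases eq_or_ne i u with rfl | h
    · simpa using hβ'
    · simpa [h] using hzX i
  -- Either the step at `u` alone keeps `c` satisfied, or it is compensated by another variable.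
  have hcases : (∑ i with A c i = 1, (z i : ℤ) + s ≤ d c ∧
      (∑ i with A c i = 1, x i = d c → (-s : ℝ) ≤ 0)) ∨
      ∃ v, A c v = 1 ∧ v ≠ u ∧ 0 < ((-s : ℤ) : ℝ) * (x v - z v) := by
    by_contra hcon
    obtain ⟨h₁, h₂⟩ := not_or.1 hcon
    have h₃ : ∀ v, A c v = 1 → v ≠ u → 0 ≤ (s : ℝ) * (x v - z v) := by
      intro v hv hvu
      by_contra h
      exact h₂ ⟨v, hv, hvu, by push_cast; linarith⟩
    have h₄ : 0 < ∑ i with A c i = 1, (s : ℝ) * (x i - z i) := by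
      refine sum_pos' (fun i hi => ?_) ⟨u, huN, hsx⟩
      rcases eq_or_ne i u with rfl | h
      · exact hsx.le
      · exact h₃ i (by simpa using hi) h
    rw [← mul_sum, sum_sub_distrib] at h₄
    have hxc := hx.1 c
    have hzc' : ∑ i with A c i = 1, (z i : ℝ) ≤ d c := by exact_mod_cast hzc
    refine h₁ ?_
    rcases hs with rfl | rfl
    · refine ⟨?_, fun _ => by simp⟩
      have : ∑ i with A c i = 1, (z i : ℝ) < d c := by push_cast at h₄; linarith
      -- Integrality of `z` and `d` turns strict slack into room for a whole unit.
      have : ∑ i with A c i = 1, (z i : ℤ) < d c := by exact_mod_cast this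
      omega
    -- A downward step never violates `c`; here the sum of `x` is below that of `z`, so `c` cannot
    -- be tight at `x`.
    · refine ⟨by omega, fun h => ?_⟩
      push_cast at h₄
      linarith
  rcases hcases with ⟨h₁, h₂⟩ | ⟨v, hv, hvu, hvx⟩
  · refine ⟨0, IsDeviation.zero fun c' hc' => ?_, ?_⟩
    · rcases eq_or_ne c' c with rfl | h
      · simpa using h₂ hc'
      · simp [h]
    · have h := sum_le_conMessage (w := w) (ν := ν) (u := u) hle_update
        (A := A) (c := c) (d := d)
        (by simpa [hsum_update, sum_add_distrib, sum_ite_eq', hu] using h₁)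
      rw [Function.update_self] at h
      refine le_trans (le_of_eq ?_) h
      rw [hmax]
      simp only [Pi.zero_apply, mul_zero, sum_const_zero, WithBot.coe_zero, add_zero]
      exact sum_congr rfl fun i hi => by rw [Function.update_of_ne (ne_of_mem_erase hi)]
  · have hvN : v ∈ univ.filter fun i => A c i = 1 := by simpa using hv
    have hvN' : v ∈ (univ.filter fun i => A c i = 1).erase u := mem_erase.2 ⟨hvu, hvN⟩
    have hνv : ν v c (z v) ≠ ⊥ :=
      withBot_term_ne_bot_of_sum (f := fun i => ν i c (z i)) (hmax ▸ hbot) hvN'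
    obtain ⟨γ, hγX, hγ⟩ := exists_step_towards (by omega) (hx.2 v).1 (hx.2 v).2 (hzX v) hvx
    obtain ⟨D, hD, hDν⟩ := hν v hv _ γ (hzX v) hγX hγ hvx hνv
    refine ⟨D, hD, ?_⟩
    have h := sum_le_conMessage (w := w) (ν := ν) (u := u)
      (z := Function.update (Function.update z u β') v γ) (A := A) (X := X) (c := c) (d := d) ?_ ?_
    · rw [Function.update_of_ne hvu.symm, Function.update_self] at h
      refine le_trans ?_ h
      rw [hmax, ← add_sum_erase _ _ hvN', ← add_sum_erase _ _ hvN', Function.update_self,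
        add_right_comm]
      refine add_le_add hDν (sum_le_sum fun i hi => le_of_eq ?_)
      rw [Function.update_of_ne (ne_of_mem_erase hi),
        Function.update_of_ne (ne_of_mem_erase (mem_of_mem_erase hi))]
    · intro i
      rcases eq_or_ne i v with rfl | h
      · simpa using hγX
      · simpa [h] using hle_update i
    -- The steps `s` at `u` and `-s` at `v` cancel in the sum over `c`.
    · have : ∀ i, (Function.update (Function.update z u β') v γ i : ℤ) =
          z i + (if i = u then s else 0) + if i = v then -s else 0 := by
        intro i
        rcases eq_or_ne i v with rfl | h
        · simp [hvu, hγ]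
        · simpa [h] using hsum_update i
      simpa [this, sum_add_distrib, sum_ite_eq', hu, hv] using hzc

/-- The deviation is the step at `u` together with the deviations of the subtrees below the
constraints in `S`. The step is allowed by the box because it goes towards `x u`. -/
theorem hasDeviations_varValue {x : Fin n → ℝ} {μ : Fin m → Fin n → ℕ → WithBot ℝ} {u : Fin n}
    {s : ℤ} (hs : s = 1 ∨ s = -1) (S : Finset (Fin m))
    (hμ : ∀ c ∈ S, HasDeviations A d w X x u s (Pi.single c (-s : ℝ)) (μ c u)) :
    HasDeviations A d w X x u s
      ((fun c => if A c u = 1 then (s : ℝ) else 0) + ∑ c ∈ S, Pi.single c (-s : ℝ))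
      (fun β => ((w u * β : ℝ) : WithBot ℝ) + ∑ c ∈ S, μ c u β) := by
  intro β β' hβ hβ' hββ' hsx hbot
  have hμbot : ∀ c ∈ S, μ c u β ≠ ⊥ := fun c hc =>
    withBot_term_ne_bot_of_sum (f := fun c => μ c u β)
      (fun h => hbot (by simp only [h, WithBot.add_bot])) hc
  choose! D hD hDμ using fun c hc => hμ c hc β β' hβ hβ' hββ' hsx (hμbot c hc)
  refine ⟨Pi.single u (s : ℝ) + ∑ c ∈ S, D c,
    (IsDeviation.single (fun h => ?_) fun h => ?_).add (IsDeviation.sum S hD), ?_⟩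
  · rw [h] at hsx
    rcases hs with rfl | rfl
    · have : (0 : ℝ) ≤ β := by positivity
      push_cast at hsx
      linarith
    · simp
  · rw [h] at hsx
    rcases hs with rfl | rfl
    · simp
    · have : (β : ℝ) ≤ X u := by exact_mod_cast hβ
      push_cast at hsx
      linarith
  · have hw : ∑ i, w i * (Pi.single u (s : ℝ) + ∑ c ∈ S, D c : Fin n → ℝ) i =
        w u * s + ∑ c ∈ S, ∑ i, w i * D c i := by
      simp only [Pi.add_apply, mul_add, sum_add_distrib, Finset.sum_apply, mul_sum]
      rw [sum_comm (s := univ)]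
      simp [Pi.single_apply]
    have hβr : (β' : ℝ) = β + s := by exact_mod_cast hββ'
    beta_reduce
    rw [hw, hβr, mul_add, WithBot.coe_add, WithBot.coe_add, WithBot.coe_sum, add_add_add_comm,
      ← sum_add_distrib]
    exact add_le_add le_rfl (sum_le_sum hDμ)

theorem HasDeviations.mono {x : Fin n → ℝ} {u : Fin n} {s : ℤ} {e e' : Fin m → ℝ}
    {f : ℕ → WithBot ℝ} (h : HasDeviations A d w X x u s e f) (he : ∀ c, e' c ≤ e c) :
    HasDeviations A d w X x u s e' f := by
  intro β β' h₁ h₂ h₃ h₄ h₅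
  obtain ⟨D, hD, hD'⟩ := h β β' h₁ h₂ h₃ h₄ h₅
  exact ⟨D, hD.mono he, hD'⟩

/-- The sign is that of the step at the root of a computation tree with `k` further levels of
variables, whose leaves make a positive step. -/
theorem hasDeviations_message {x : Fin n → ℝ} (hx : x ∈ packingFeasible A d X) (k : ℕ)
    (u : Fin n) (c : Fin m) (hu : A c u = 1) :
    HasDeviations A d w X x u ((-1) ^ k) (Pi.single c (-(((-1) ^ k : ℤ) : ℝ)))
      ((packingModel A d w X).message k c u) := by
  induction k generalizing u c with
  | zero =>
    intro β β' _ _ _ _ _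
    -- The zero deviation suffices because `s = 1` here, so the required bound at `c` is `-1 ≤ 0`.
    refine ⟨0, IsDeviation.zero fun c' _ => ?_, by simp [FactorGraphModel.message]⟩
    rcases eq_or_ne c' c with rfl | h
    · simp
    · simp [h]
  | succ k ih =>
    refine hasDeviations_conMessage (neg_one_pow_eq_or ℤ (k + 1)) hx hu fun v hv => ?_
    have h := hasDeviations_varValue (neg_one_pow_eq_or ℤ k)
      (((packingModel A d w X).varNbrs v).erase c)
      fun c' hc' => ih v c' (mem_varNbrs.1 (mem_of_mem_erase hc'))
    have hk : -(-1 : ℤ) ^ (k + 1) = (-1) ^ k := by ring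
    rw [← Int.cast_neg, hk]
    refine h.mono fun c' => ?_
    -- The contributions `s` and `-s` cancel at every neighbour of `v` except `c`, whose subtree is
    -- not included.
    rcases eq_or_ne c' c with rfl | hc
    · simp [Finset.sum_apply, Pi.single_apply, hv]
    · by_cases h' : A c' v = 1 <;>
        simp [Finset.sum_apply, Pi.single_apply, mem_varNbrs, h', hc]

/-- At the root all neighbouring constraints are included, so every bound cancels to `0`, as
`IsDeviation.weight_nonneg` needs. -/
theorem hasDeviations_finalValue {x : Fin n → ℝ} (hx : x ∈ packingFeasible A d X) (k : ℕ)
    (u : Fin n) :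
    HasDeviations A d w X x u ((-1) ^ k) 0 ((packingModel A d w X).finalValue k u) := by
  refine (hasDeviations_varValue (neg_one_pow_eq_or ℤ k) ((packingModel A d w X).varNbrs u)
    fun c hc => hasDeviations_message hx k u c (mem_varNbrs.1 hc)).mono fun c => ?_
  by_cases h : A c u = 1 <;> simp [Finset.sum_apply, Pi.single_apply, mem_varNbrs, h]

/-! ### Finiteness and maximizing letters. -/

/-- The all-zero assignment satisfies every constraint when `d ≥ 0`. Hence the maximal final value
is finite, as `HasDeviations` demands. -/
theorem message_zero_ne_bot (hd : ∀ c, 0 ≤ d c) (k : ℕ) (c : Fin m) (u : Fin n) :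
    (packingModel A d w X).message k c u 0 ≠ ⊥ := by
  induction k generalizing c u with
  | zero => simp [FactorGraphModel.message]
  | succ k ih =>
    have h := sum_le_conMessage (A := A) (d := d) (w := w) (X := X)
      (ν := (packingModel A d w X).varMessage ((packingModel A d w X).message k))
      (c := c) (u := u) (z := fun _ => 0) (fun _ => Nat.zero_le _) (by simpa using hd c)
    refine ne_bot_of_le_ne_bot (fun hbot => ?_) h
    obtain ⟨i, -, hi⟩ := WithBot.sum_eq_bot_iff.1 hbot
    rw [FactorGraphModel.varMessage, WithBot.add_eq_bot] at hi
    obtain ⟨c', -, hc'⟩ := WithBot.sum_eq_bot_iff.1 (hi.resolve_left WithBot.coe_ne_bot)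
    exact ih c' i hc'

theorem finalValue_zero_ne_bot (hd : ∀ c, 0 ≤ d c) (k : ℕ) (u : Fin n) :
    (packingModel A d w X).finalValue k u 0 ≠ ⊥ := by
  intro h
  rw [FactorGraphModel.finalValue, WithBot.add_eq_bot] at h
  obtain ⟨c, -, hc⟩ := WithBot.sum_eq_bot_iff.1 (h.resolve_left WithBot.coe_ne_bot)
  exact message_zero_ne_bot hd k c u hc

theorem mem_packingDelta {t : ℕ} {r : Fin n} {β : ℕ} :
    β ∈ (packingModel A d w X).packingDelta t r ↔ β ≤ X r ∧ ∀ β' ≤ X r,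
      (packingModel A d w X).finalValue t r β' ≤ (packingModel A d w X).finalValue t r β := by
  unfold FactorGraphModel.packingDelta
  rw [mem_filter, mem_range, Nat.lt_succ_iff]
  refine and_congr_right fun hβ => ⟨fun h β' hβ' => ?_, fun h => le_antisymm ?_ ?_⟩
  · rw [h]
    exact Finset.le_sup (mem_range.2 (Nat.lt_succ_iff.2 hβ'))
  · exact Finset.le_sup (mem_range.2 (Nat.lt_succ_iff.2 hβ))
  · exact Finset.sup_le fun β' hβ' => h β' (Nat.lt_succ_iff.1 (mem_range.1 hβ'))

theorem packingDelta_nonempty (t : ℕ) (r : Fin n) :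
    ((packingModel A d w X).packingDelta t r).Nonempty := by
  obtain ⟨β, hβ, hmax⟩ := exists_max_image (range (X r + 1))
    ((packingModel A d w X).finalValue t r) ⟨0, by simp⟩
  exact ⟨β, mem_packingDelta.2 ⟨Nat.lt_succ_iff.1 (mem_range.1 hβ),
    fun β' h => hmax β' (mem_range.2 (Nat.lt_succ_iff.2 h))⟩⟩

/-- A maximizing letter which lies on the wrong side of an LP optimum has a maximizing neighbour
in the direction of that optimum. -/
theorem exists_mem_packingDelta {x : Fin n → ℝ} (hd : ∀ c, 0 ≤ d c)
    (hx : x ∈ packingFeasible A d X)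
    (hopt : ∀ y ∈ packingFeasible A d X, ∑ i, w i * y i ≤ ∑ i, w i * x i) {t : ℕ} {r : Fin n}
    {β : ℕ} (hβ : β ∈ (packingModel A d w X).packingDelta t r)
    (h : 0 < (((-1) ^ t : ℤ) : ℝ) * (x r - β)) :
    ∃ β' ∈ (packingModel A d w X).packingDelta t r, (β' : ℤ) = β + (-1) ^ t := by
  obtain ⟨hβX, hmax⟩ := mem_packingDelta.1 hβ
  obtain ⟨β', hβ'X, hβ'⟩ :=
    exists_step_towards (neg_one_pow_eq_or ℤ t) (hx.2 r).1 (hx.2 r).2 hβX h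
  have hbot := ne_bot_of_le_ne_bot (finalValue_zero_ne_bot hd t r) (hmax 0 (Nat.zero_le _))
  obtain ⟨D, hD, hDw⟩ := hasDeviations_finalValue hx t r β β' hβX hβ'X hβ' h hbot
  have hw : (0 : WithBot ℝ) ≤ ((∑ i, w i * D i : ℝ) : WithBot ℝ) := by
    exact_mod_cast hD.weight_nonneg (fun _ => le_rfl) hx hopt
  exact ⟨β', mem_packingDelta.2 ⟨hβ'X, fun γ hγ =>
    (hmax γ hγ).trans ((le_add_of_nonneg_right hw).trans hDw)⟩, hβ'⟩

/-! ### Complementation between covering and packing, and existence of LP optima. -/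

theorem sum_zero_one_mul (hA : ∀ j i, A j i = 0 ∨ A j i = 1) (j : Fin m) (x : Fin n → ℝ) :
    ∑ i, (A j i : ℝ) * x i = ∑ i with A j i = 1, x i := by
  rw [sum_filter]
  refine sum_congr rfl fun i _ => ?_
  rcases hA j i with h | h <;> simp [h]

theorem sub_mem_packingFeasible_iff (hA : ∀ j i, A j i = 0 ∨ A j i = 1) {b : Fin m → ℤ}
    {x : Fin n → ℝ} :
    (fun i => (X i : ℝ) - x i) ∈ packingFeasible A (A.mulVec (fun i => (X i : ℤ)) - b) X ↔
      x ∈ coveringFeasible A b X := by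
  have h (j : Fin m) : (((A.mulVec (fun i => (X i : ℤ)) - b) j : ℤ) : ℝ) =
      ∑ i with A j i = 1, (X i : ℝ) - b j := by
    rw [← sum_zero_one_mul hA]
    simp [Matrix.mulVec, dotProduct]
  refine and_congr (forall_congr' fun j => ?_) (forall_congr' fun i => ?_)
  · rw [h, sum_sub_distrib, sub_le_sub_iff_left, sum_zero_one_mul hA]
  · rw [sub_nonneg, sub_le_self_iff, and_comm]

theorem isCompact_coveringFeasible (b : Fin m → ℤ) : IsCompact (coveringFeasible A b X) := by
  have h : coveringFeasible A b X =
      (Set.univ.pi fun i => Set.Icc 0 (X i : ℝ)) ∩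
        ⋂ j, {x | (b j : ℝ) ≤ ∑ i, (A j i : ℝ) * x i} := by
    ext x
    simp only [coveringFeasible, Set.mem_ofPred_eq, Set.mem_inter_iff, Set.mem_univ_pi, Set.mem_Icc,
      Set.mem_iInter]
    exact and_comm
  rw [h]
  exact (isCompact_univ_pi fun i => isCompact_Icc).inter_right
    (isClosed_iInter fun j => isClosed_le (by fun_prop) (by fun_prop))

theorem isCompact_coveringOpt (b : Fin m → ℤ) : IsCompact (coveringOpt A b w X) := by
  have h : coveringOpt A b w X = coveringFeasible A b X ∩
      ⋂ y ∈ coveringFeasible A b X, {x | ∑ i, w i * x i ≤ ∑ i, w i * y i} := by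
    ext x
    simp [coveringOpt]
  rw [h]
  exact (isCompact_coveringFeasible b).inter_right
    (isClosed_biInter fun y _ => isClosed_le (by fun_prop) (by fun_prop))

theorem coveringOpt_nonempty {b : Fin m → ℤ} (h : (coveringFeasible A b X).Nonempty) :
    (coveringOpt A b w X).Nonempty := by
  obtain ⟨x, hx, hmin⟩ := (isCompact_coveringFeasible b).exists_isMinOn h
    (f := fun x => ∑ i, w i * x i) (by fun_prop)
  exact ⟨x, hx, fun y hy => hmin hy⟩

theorem exists_mem_coveringDelta (hA : ∀ j i, A j i = 0 ∨ A j i = 1) {b : Fin m → ℤ}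
    {x : Fin n → ℝ} (hx : x ∈ coveringOpt A b w X) {t : ℕ} {r : Fin n} {δ : ℕ}
    (hδ : δ ∈ coveringDelta A b w X t r) (h : 0 < (((-1) ^ t : ℤ) : ℝ) * (δ - x r)) :
    ∃ δ' ∈ coveringDelta A b w X t r, (δ' : ℤ) = δ - (-1) ^ t := by
  obtain ⟨β, hβ, rfl⟩ := mem_image.1 hδ
  have hβX := (mem_packingDelta.1 hβ).1
  have hxp := (sub_mem_packingFeasible_iff hA).2 hx.1
  -- LP feasibility of the packing problem gives `d ≥ 0`, since `d c` bounds a sum of nonnegative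
  -- terms.
  have hd : ∀ c, 0 ≤ (A.mulVec (fun i => (X i : ℤ)) - b) c := fun c => by
    exact_mod_cast (sum_nonneg fun i _ => (hxp.2 i).1).trans (hxp.1 c)
  have hopt : ∀ y ∈ packingFeasible A (A.mulVec (fun i => (X i : ℤ)) - b) X,
      ∑ i, w i * y i ≤ ∑ i, w i * (X i - x i) := fun y hy => by
    have := hx.2 (fun i => X i - y i) ((sub_mem_packingFeasible_iff hA).1 (by simpa using hy))
    simp only [mul_sub, sum_sub_distrib] at this ⊢
    linarith
  obtain ⟨β', hβ', hββ'⟩ := exists_mem_packingDelta hd hxp hopt hβ (by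
    rw [Nat.cast_sub hβX] at h
    convert h using 2
    ring)
  have hβX' := (mem_packingDelta.1 hβ').1
  exact ⟨X r - β', mem_image.2 ⟨β', hβ', rfl⟩, by omega⟩

end MinSum

theorem theorem2 {m n : ℕ} (A : Matrix (Fin m) (Fin n) ℤ)
    (hA : ∀ j i, A j i = 0 ∨ A j i = 1) (b : Fin m → ℤ) (w : Fin n → ℝ) (X : Fin n → ℕ)
    (hfeas : (MinSum.coveringFeasible A b X).Nonempty) (t : ℕ) (r : Fin n) :
    (Even t → ∃ (δmin : ℕ) (xmin : ℝ),
      IsLeast (MinSum.coveringDelta A b w X t r : Set ℕ) δmin ∧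
      IsLeast ((fun x : Fin n → ℝ => x r) '' MinSum.coveringOpt A b w X) xmin ∧
      (δmin : ℝ) ≤ xmin) ∧
    (Odd t → ∃ (δmax : ℕ) (xmax : ℝ),
      IsGreatest (MinSum.coveringDelta A b w X t r : Set ℕ) δmax ∧
      IsGreatest ((fun x : Fin n → ℝ => x r) '' MinSum.coveringOpt A b w X) xmax ∧
      xmax ≤ (δmax : ℝ)) := by
  have hne : (MinSum.coveringDelta A b w X t r).Nonempty :=
    (MinSum.packingDelta_nonempty t r).image _
  have hcpt : IsCompact ((fun x : Fin n → ℝ => x r) '' MinSum.coveringOpt A b w X) :=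
    (MinSum.isCompact_coveringOpt b).image (continuous_apply r)
  have hopt := (MinSum.coveringOpt_nonempty (w := w) hfeas).image fun x : Fin n → ℝ => x r
  refine ⟨fun ht => ?_, fun ht => ?_⟩
  · obtain ⟨xmin, hxmin⟩ := hcpt.exists_isLeast hopt
    have hδ := Finset.isLeast_min' _ hne
    refine ⟨_, xmin, hδ, hxmin, ?_⟩
    obtain ⟨x, hx, rfl⟩ := hxmin.1
    -- If the least letter exceeded `xmin`, the next letter towards `xmin`, one smaller, would also
    -- be in `coveringDelta`.
    by_contra! hlt
    obtain ⟨δ', hδ', heq⟩ := MinSum.exists_mem_coveringDelta hA hx hδ.1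
      (by simpa [ht.neg_one_pow] using hlt)
    have := hδ.2 hδ'
    rw [ht.neg_one_pow] at heq
    omega
  · obtain ⟨xmax, hxmax⟩ := hcpt.exists_isGreatest hopt
    have hδ := Finset.isGreatest_max' _ hne
    refine ⟨_, xmax, hδ, hxmax, ?_⟩
    obtain ⟨x, hx, rfl⟩ := hxmax.1
    by_contra! hlt
    obtain ⟨δ', hδ', heq⟩ := MinSum.exists_mem_coveringDelta hA hx hδ.1
      (by simpa [ht.neg_one_pow] using hlt)
    have := hδ.2 hδ'
    rw [ht.neg_one_pow] at heq
    omega
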